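/- Let $c\in\mathbb{R}$ and let $\phi:\mathbb{R}\to\mathbb{R}$ be a bounded function satisfying the following two conditions. (TW1) There are countably many pairwise disjoint open intervals $E_i$, $i\ge 1$ (some of which may be empty, so that finite families are included; bounded and unbounded intervals are allowed), and a closed set $C\subset\mathbb{R}$ such that $\mathbb{R}\setminus C=\bigcup_{i\ge1}E_i$, $\phi\in C^\infty(E_i)$ for every $i\ge1$, $\phi(\xi)\neq c$ for $\xi\in\bigcup_{i\ge1}E_i$, and $\phi(\xi)=c$ for $\xi\in C$. (TW2) With these $E_i$ and $C$, there is an $a\in\mathbb{R}$ such that (i) for each $i\ge1$ there is a $d_i\in\mathbb{R}$ with $$(\phi')^2=\frac{\phi^2\left(c-\frac{\phi^2}{2}\right)+a\phi+d_i}{c-\phi}\quad\text{on }E_i,$$ and $\phi(\xi)\to c$ as $\xi$ tends, within $E_i$, to any finite endpoint of $E_i$; (ii) if $C$ has strictly positive Lebesgue measure, then $a=2c^3-2c^2$. Then $\phi\in H^1_{\mathrm{loc}}(\mathbb{R})$, and (TW3) holds, that is, $(\phi-c)^2\in W^{2,1}_{\mathrm{loc}}(\mathbb{R})$. Here $W^{k,p}_{\mathrm{loc}}(\mathbb{R})$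 is the space of functions which, together with their weak (distributional) derivatives up to order $k$, belong to $L^p_{\mathrm{loc}}(\mathbb{R})$, and $H^1_{\mathrm{loc}}=W^{1,2}_{\mathrm{loc}}$. -/

import Mathlib

open MeasureTheory Set Filter Topology
open scoped ContDiff ENNReal

namespace MCHWave

/-- `f ∈ L^p_loc(ℝ)`: `f` is in `L^p` on every compact subset of the line. -/
def MemLpLoc (p : ℝ≥0∞) (f : ℝ → ℝ) : Prop :=
  ∀ K : Set ℝ, IsCompact K → MemLp f p (volume.restrict K)

/-- `g` is the weak (distributional) derivative of `f` on `ℝ`; both are locally integrable, and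
`∫ f ψ' = - ∫ g ψ` for every smooth compactly supported test function `ψ`. -/
def HasWeakDeriv (f g : ℝ → ℝ) : Prop :=
  LocallyIntegrable f volume ∧ LocallyIntegrable g volume ∧
    ∀ ψ : ℝ → ℝ, ContDiff ℝ ∞ ψ → HasCompactSupport ψ →
      ∫ x, f x * deriv ψ x = - ∫ x, g x * ψ x

/-- The local Sobolev space `W^{k,p}_loc(ℝ)`: the function and its weak derivatives of orders
`1, …, k` exist and lie in `L^p_loc(ℝ)`. -/
def MemWLoc : ℕ → ℝ≥0∞ → (ℝ → ℝ) → Prop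
  | 0, p, f => MemLpLoc p f
  | k + 1, p, f => MemLpLoc p f ∧ ∃ g : ℝ → ℝ, HasWeakDeriv f g ∧ MemWLoc k p g

/-- `H^1_loc(ℝ) = W^{1,2}_loc(ℝ)`. -/
def MemH1Loc (f : ℝ → ℝ) : Prop := MemWLoc 1 2 f

/-- Condition (TW1) for `φ` with speed `c`, witnessed by the intervals `E i` and the closed set `C`.
The `E i` are pairwise disjoint open intervals (open order-connected subsets of `ℝ`: bounded,
half-lines or the whole line). Some of them may be empty, so that finite families, including
the empty one, are covered. -/
structure TW1 (c : ℝ) (φ : ℝ → ℝ) (E : ℕ → Set ℝ) (C : Set ℝ) : Prop where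
  isOpen : ∀ i, IsOpen (E i)
  ordConnected : ∀ i, (E i).OrdConnected
  disjoint : Pairwise fun i j => Disjoint (E i) (E j)
  isClosed : IsClosed C
  compl_eq : Cᶜ = ⋃ i, E i
  smooth : ∀ i, ContDiffOn ℝ ∞ φ (E i)
  ne_c : ∀ ξ ∈ ⋃ i, E i, φ ξ ≠ c
  eq_c : ∀ ξ ∈ C, φ ξ = c

/-- The rational function `F(y) = (y² (c - y²/2) + a y + d) / (c - y)`. -/
noncomputable def waveF (c a d y : ℝ) : ℝ :=
  (y ^ 2 * (c - y ^ 2 / 2) + a * y + d) / (c - y)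

/-- Condition (TW2) for `φ` with speed `c`, relative to the intervals `E i` and the set `C`.
The finite endpoints of the open interval `E i` are the points of its frontier in `ℝ`. -/
def TW2 (c : ℝ) (φ : ℝ → ℝ) (E : ℕ → Set ℝ) (C : Set ℝ) : Prop :=
  ∃ a : ℝ,
    (∀ i, ∃ d : ℝ,
      (∀ ξ ∈ E i, (deriv φ ξ) ^ 2 = waveF c a d (φ ξ)) ∧
      ∀ x ∈ frontier (E i), Tendsto φ (𝓝[E i] x) (𝓝 c)) ∧
    (0 < volume C → a = 2 * c ^ 3 - 2 * c ^ 2)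

/-- Condition (TW3): `(φ - c)² ∈ W^{2,1}_loc(ℝ)`. -/
def TW3 (c : ℝ) (φ : ℝ → ℝ) : Prop := MemWLoc 2 1 fun ξ => (φ ξ - c) ^ 2

end MCHWave

namespace MCHWave

/-! The difficulty is that infinitely many components may accumulate, each with its own `d i`. Put w
= (φ - c)², so w' = 2(φ - c)φ' and w'' = 2φ'² + 2(φ - c)φ'' on the components. Clearing the
denominator in the first-order equation and differentiating removes `d i`: φ'² + 2(φ - c)φ'' is
bounded by a constant L depending only on a, c and sup |φ| (`abs_sq_deriv_add_le`). Hence φ'² ≤ w''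
+ L.

Since w'² = 4(c - φ)P(φ), with P the numerator of `waveF`, w' vanishes at every finite endpoint
(`tendsto_flux_zero`). Integrating over the components inside (-R, R) leaves boundary terms only at
±R, so φ' is locally square integrable (`lintegral_iUnion_component_lt_top`), and |w''| ≤ L + φ'² is
locally integrable.

Finally φ - c, w and w' vanish on C and at the endpoints, so integration by parts on each component
shows that their classical derivatives, extended by zero, are weak derivatives
(`hasWeakDeriv_of_components`). -/

/-! ### Zero extension and weak derivatives -/

/-- Extending a continuous function by zero across the boundary of an open set. -/
lemma continuous_indicator_of_tendsto_frontier {E : Set ℝ} (hE : IsOpen E) {f : ℝ → ℝ}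
    (hf : ContinuousOn f E) (h0 : ∀ x ∈ frontier E, Tendsto f (𝓝[E] x) (𝓝 0)) :
    Continuous (E.indicator f) := by
  refine continuous_iff_continuousAt.2 fun x => ?_
  by_cases hx : x ∈ E
  · exact (hf.continuousAt (hE.mem_nhds hx)).congr
      (eventually_of_mem (hE.mem_nhds hx) fun y hy => (indicator_of_mem hy f).symm)
  · rw [ContinuousAt, indicator_of_notMem hx, ← nhdsWithin_univ, ← union_compl_self E,
      nhdsWithin_union]
    refine Tendsto.sup ?_ ?_
    · have hfE : Tendsto f (𝓝[E] x) (𝓝 0) := by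
        by_cases hxc : x ∈ closure E
        · exact h0 x ⟨hxc, by rwa [hE.interior_eq]⟩
        · rw [notMem_closure_iff_nhdsWithin_eq_bot.1 hxc]
          exact tendsto_bot
      exact hfE.congr' (eventually_of_mem self_mem_nhdsWithin
        fun y hy => (indicator_of_mem hy f).symm)
    · exact tendsto_const_nhds.congr' (eventually_of_mem self_mem_nhdsWithin
        fun y hy => (indicator_of_notMem hy f).symm)

/-- Supplies the exceptional set allowed in the fundamental theorem of calculus for the zero
extension. -/
lemma countable_frontier_of_ordConnected {E : Set ℝ} (hE : E.OrdConnected) :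
    (frontier E).Countable := by
  have h := hE.isPreconnected.mem_intervals
  simp only [mem_insert_iff, mem_singleton_iff] at h
  have hsub : frontier E ⊆ {sInf E, sSup E} := by
    generalize sInf E = a at h ⊢
    generalize sSup E = b at h ⊢
    rcases lt_trichotomy a b with hab | rfl | hab
    · rcases h with rfl | rfl | rfl | rfl | rfl | rfl | rfl | rfl | rfl | rfl <;>
        simp [frontier_Icc hab.le, frontier_Ico hab, frontier_Ioc hab, frontier_Ioo hab]
    · rcases h with rfl | rfl | rfl | rfl | rfl | rfl | rfl | rfl | rfl | rfl <;>
        simp [isClosed_singleton.frontier_eq]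
    · rcases h with rfl | rfl | rfl | rfl | rfl | rfl | rfl | rfl | rfl | rfl <;>
        simp [hab.not_ge, hab.not_gt]
  exact (Set.toFinite {sInf E, sSup E}).countable.mono hsub

/-- Integration by parts against a test function on an interval at whose finite endpoints the
function vanishes. -/
lemma setIntegral_mul_deriv_add_eq_zero {E : Set ℝ} (hE : IsOpen E) (hEc : E.OrdConnected)
    {f g ψ : ℝ → ℝ} (hd : ∀ x ∈ E, HasDerivAt f (g x) x)
    (h0 : ∀ x ∈ frontier E, Tendsto f (𝓝[E] x) (𝓝 0))
    (hψ : ContDiff ℝ ∞ ψ) (hψc : HasCompactSupport ψ)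
    (hint : IntegrableOn (fun x => f x * deriv ψ x + g x * ψ x) E) :
    ∫ x in E, (f x * deriv ψ x + g x * ψ x) = 0 := by
  have hψd : Differentiable ℝ ψ := hψ.differentiable (by simp)
  obtain ⟨R, hR⟩ := hψc.isCompact.isBounded.subset_ball 0
  rw [Real.ball_eq_Ioo, zero_sub, zero_add] at hR
  -- Enlarging R keeps [-R', R'] nondegenerate and puts ±R' outside the support of ψ.
  set R' := |R| + 1 with hR'
  have hRR : R < R' := by have := le_abs_self R; linarith
  have hR'0 : 0 < R' := by positivity
  have hout : ∀ x, x ∉ Ioo (-R') R' → x ∉ tsupport ψ := fun x hx hxs => by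
    have := hR hxs
    exact hx ⟨by linarith [this.1], by linarith [this.2]⟩
  have hzero : ∀ x, x ∉ Ioo (-R') R' → ψ x = 0 ∧ deriv ψ x = 0 := fun x hx =>
    ⟨image_eq_zero_of_notMem_tsupport (hout x hx),
      image_eq_zero_of_notMem_tsupport fun h => hout x hx (tsupport_deriv_subset h)⟩
  set F' := E.indicator fun x => f x * deriv ψ x + g x * ψ x with hF'
  have hF'int : Integrable F' := hint.integrable_indicator hE.measurableSet
  have hcont : Continuous fun x => E.indicator f x * ψ x :=
    (continuous_indicator_of_tendsto_frontier hE
      (fun x hx => (hd x hx).continuousAt.continuousWithinAt) h0).mul hψ.continuous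
  -- Off the frontier a point lies either in E or in the exterior, where the extended product is
  -- locally zero.
  have key := MeasureTheory.integral_eq_of_hasDerivAt_off_countable_of_le
    (fun x => E.indicator f x * ψ x) F' (a := -R') (b := R') (by linarith)
    (countable_frontier_of_ordConnected hEc) hcont.continuousOn (fun x hx => ?_)
    hF'int.intervalIntegrable
  · rw [← integral_indicator hE.measurableSet, ← hF',
      ← intervalIntegral.integral_eq_integral_of_support_subset (a := -R') (b := R'), key,
      (hzero R' (by simp)).1, (hzero (-R') (by simp)).1]
    · simp
    · intro x hx
      by_contra hx'
      have := hzero x fun h => hx' ⟨h.1, h.2.le⟩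
      apply hx
      simp [hF', indicator, this.1, this.2]
  · by_cases hxE : x ∈ E
    · have h1 : HasDerivAt (E.indicator f) (g x) x := (hd x hxE).congr_of_eventuallyEq
        (eventually_of_mem (hE.mem_nhds hxE) fun y hy => indicator_of_mem hy f)
      have h2 := h1.fun_mul (hψd x).hasDerivAt
      rw [indicator_of_mem hxE, add_comm] at h2
      rwa [hF', indicator_of_mem hxE]
    · have hxc : x ∉ closure E := fun h => hx.2 ⟨h, by rwa [hE.interior_eq]⟩
      rw [hF', indicator_of_notMem hxE]
      refine (hasDerivAt_const x (0 : ℝ)).congr_of_eventuallyEq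
        (eventually_of_mem (isClosed_closure.isOpen_compl.mem_nhds hxc) fun y hy => ?_)
      simp [indicator_of_notMem fun h => hy (subset_closure h)]

/-- A function vanishing off a disjoint union of open intervals and at their endpoints has its
classical derivative as weak derivative. -/
lemma hasWeakDeriv_of_components {E : ℕ → Set ℝ} (hE : ∀ i, IsOpen (E i))
    (hEc : ∀ i, (E i).OrdConnected) (hdisj : Pairwise fun i j => Disjoint (E i) (E j))
    {f g : ℝ → ℝ} (hf : LocallyIntegrable f volume) (hg : LocallyIntegrable g volume)
    (hf0 : ∀ x ∉ ⋃ i, E i, f x = 0) (hg0 : ∀ x ∉ ⋃ i, E i, g x = 0)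
    (hd : ∀ x ∈ ⋃ i, E i, HasDerivAt f (g x) x)
    (h0 : ∀ i, ∀ x ∈ frontier (E i), Tendsto f (𝓝[E i] x) (𝓝 0)) :
    HasWeakDeriv f g := by
  refine ⟨hf, hg, fun ψ hψ hψc => ?_⟩
  have hfi : Integrable fun x => f x * deriv ψ x := by
    simpa [mul_comm] using hf.integrable_smul_left_of_hasCompactSupport
      (hψ.continuous_deriv (by simp)) hψc.deriv
  have hgi : Integrable fun x => g x * ψ x := by
    simpa [mul_comm] using hg.integrable_smul_left_of_hasCompactSupport hψ.continuous hψc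
  -- Integrability on the whole line justifies splitting the integral over infinitely many
  -- components.
  rw [eq_neg_iff_add_eq_zero, ← integral_add hfi hgi,
    ← setIntegral_eq_integral_of_forall_compl_eq_zero (s := ⋃ i, E i)
      (fun x hx => by simp [hf0 x hx, hg0 x hx]),
    integral_iUnion (f := fun x => f x * deriv ψ x + g x * ψ x)
      (fun i => (hE i).measurableSet) hdisj (hfi.add hgi).integrableOn]
  refine (tsum_congr fun i => ?_).trans tsum_zero
  exact setIntegral_mul_deriv_add_eq_zero (hE i) (hEc i)
    (fun x hx => hd x (mem_iUnion_of_mem i hx)) (h0 i) hψ hψc (hfi.add hgi).integrableOn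

/-- Passes from φ - c, which vanishes off the components, back to φ. -/
lemma HasWeakDeriv.add_const {f g : ℝ → ℝ} (h : HasWeakDeriv f g) (k : ℝ) :
    HasWeakDeriv (fun x => f x + k) g := by
  refine ⟨h.1.add (locallyIntegrable_const k), h.2.1, fun ψ hψ hψc => ?_⟩
  have hψ' : Continuous (deriv ψ) := hψ.continuous_deriv (by simp)
  have hi : Integrable (deriv ψ) := hψ'.integrable_of_hasCompactSupport hψc.deriv
  have hfi : Integrable fun x => f x * deriv ψ x := by
    simpa [mul_comm] using h.1.integrable_smul_left_of_hasCompactSupport hψ' hψc.deriv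
  have hz : ∫ x, deriv ψ x = 0 := integral_eq_zero_of_hasDerivAt_of_integrable
    (fun x => (hψ.differentiable (by simp) x).hasDerivAt) hi
    (hψ.continuous.integrable_of_hasCompactSupport hψc)
  simp_rw [add_mul]
  rw [integral_add hfi (hi.const_mul k), h.2.2 ψ hψ hψc, integral_const_mul, hz]
  simp

/-! ### Energy bound summed over components -/

/-- One-sided control of a nonnegative function by a derivative bounds its integral on an open
interval, with boundary contributions only at the points `±R` that are interior to it. -/
lemma lintegral_component_le {E : Set ℝ} (hE : IsOpen E) (hEc : E.OrdConnected)
    {W W' q : ℝ → ℝ} {L : ℝ} (R : ℝ) (hd : ∀ x ∈ E, HasDerivAt W (W' x) x)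
    (h0 : ∀ x ∈ frontier E, Tendsto W (𝓝[E] x) (𝓝 0)) (hq0 : ∀ x ∈ E, 0 ≤ q x)
    (hq : ∀ x ∈ E, q x ≤ W' x + L) :
    ∫⁻ x in E ∩ Ioo (-R) R, ENNReal.ofReal (q x) ≤
      (ENNReal.ofReal L • volume.restrict (Ioo (-R) R) +
        ENNReal.ofReal |W R| • Measure.dirac R +
        ENNReal.ofReal |W (-R)| • Measure.dirac (-R)) E := by
  rcases (E ∩ Ioo (-R) R).eq_empty_or_nonempty with hJ | hJ
  · simp [hJ]
  have hJo : IsOpen (E ∩ Ioo (-R) R) := hE.inter isOpen_Ioo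
  have hJc : IsPreconnected (E ∩ Ioo (-R) R) := (hEc.inter ordConnected_Ioo).isPreconnected
  have hbb : BddBelow (E ∩ Ioo (-R) R) := bddBelow_Ioo.mono inter_subset_right
  have hba : BddAbove (E ∩ Ioo (-R) R) := bddAbove_Ioo.mono inter_subset_right
  obtain ⟨α, β, hαβ, hJeq⟩ : ∃ α β : ℝ, α < β ∧ E ∩ Ioo (-R) R = Ioo α β := by
    refine ⟨sInf (E ∩ Ioo (-R) R), sSup (E ∩ Ioo (-R) R), ?_, ?_⟩
    · obtain ⟨x, hx⟩ := hJ
      obtain ⟨l, u, hlu, hsub⟩ := mem_nhds_iff_exists_Ioo_subset.1 (hJo.mem_nhds hx)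
      obtain ⟨y, hy1, hy2⟩ := exists_between hlu.2
      exact ((csInf_le hbb hx).trans_lt hy1).trans_le
        (le_csSup hba (hsub ⟨hlu.1.trans hy1, hy2⟩))
    · refine Subset.antisymm (fun x hx => ?_)
        (IsConnected.Ioo_csInf_csSup_subset ⟨hJ, hJc⟩ hbb hba)
      obtain ⟨l, u, hlu, hsub⟩ := mem_nhds_iff_exists_Ioo_subset.1 (hJo.mem_nhds hx)
      obtain ⟨y, hy1, hy2⟩ := exists_between hlu.2
      obtain ⟨z, hz1, hz2⟩ := exists_between hlu.1
      exact ⟨(csInf_le hbb (hsub ⟨hz1, hz2.trans hlu.2⟩)).trans_lt hz2,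
        hy1.trans_le (le_csSup hba (hsub ⟨hlu.1.trans hy1, hy2⟩))⟩
  have hsubE : Ioo α β ⊆ E := hJeq ▸ inter_subset_left
  have hsubR : Ioo α β ⊆ Ioo (-R) R := hJeq ▸ inter_subset_right
  -- If β lay in E with β < R, it would belong to the open set `E ∩ Ioo (-R) R` whose supremum it
  -- is.
  have hβR : β ∈ E → β = R := fun hβ => by
    by_contra hne
    have hle := (Ioo_subset_Ioo_iff hαβ).1 hsubR
    have : β ∈ E ∩ Ioo (-R) R := ⟨hβ, hle.1.trans_lt hαβ, lt_of_le_of_ne hle.2 hne⟩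
    rw [hJeq] at this
    exact lt_irrefl _ this.2
  have hαR : α ∈ E → α = -R := fun hα => by
    by_contra hne
    have hle := (Ioo_subset_Ioo_iff hαβ).1 hsubR
    have : α ∈ E ∩ Ioo (-R) R := ⟨hα, lt_of_le_of_ne hle.1 (Ne.symm hne), hαβ.trans_le hle.2⟩
    rw [hJeq] at this
    exact lt_irrefl _ this.1
  have hWc : Continuous (E.indicator W) := continuous_indicator_of_tendsto_frontier hE
    (fun x hx => (hd x hx).continuousAt.continuousWithinAt) h0
  have hGc : Continuous fun x => E.indicator W x + L * x := by fun_prop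
  have hGd : ∀ x ∈ Ioo α β, HasDerivAt (fun x => E.indicator W x + L * x) (W' x + L) x := by
    intro x hx
    have h1 : HasDerivAt (E.indicator W) (W' x) x :=
      (hd x (hsubE hx)).congr_of_eventuallyEq
        (eventually_of_mem (hE.mem_nhds (hsubE hx)) fun y hy => indicator_of_mem hy W)
    simpa using h1.fun_add ((hasDerivAt_id' x).const_mul L)
  have hpos : ∀ x ∈ Ioo α β, 0 ≤ W' x + L := fun x hx =>
    (hq0 x (hsubE hx)).trans (hq x (hsubE hx))
  -- A nonnegative derivative of a function continuous up to the endpoints is automatically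
  -- integrable.
  have hint : IntegrableOn (fun x => W' x + L) (Ioc α β) :=
    intervalIntegral.integrableOn_deriv_of_nonneg hGc.continuousOn hGd hpos
  have hFTC := intervalIntegral.integral_eq_sub_of_hasDerivAt_of_le hαβ.le hGc.continuousOn hGd
    ((intervalIntegrable_iff_integrableOn_Ioc_of_le hαβ.le).2 hint)
  rw [intervalIntegral.integral_of_le hαβ.le, integral_Ioc_eq_integral_Ioo] at hFTC
  have hub : E.indicator W β ≤ E.indicator (fun _ => |W R|) R := by
    by_cases hβ : β ∈ E
    · rw [← hβR hβ, indicator_of_mem hβ, indicator_of_mem hβ]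
      exact le_abs_self _
    · rw [indicator_of_notMem hβ]
      exact indicator_nonneg (fun _ _ => abs_nonneg _) _
  have hua : -E.indicator W α ≤ E.indicator (fun _ => |W (-R)|) (-R) := by
    by_cases hα : α ∈ E
    · rw [← hαR hα, indicator_of_mem hα, indicator_of_mem hα]
      exact neg_le_abs _
    · rw [indicator_of_notMem hα, neg_zero]
      exact indicator_nonneg (fun _ _ => abs_nonneg _) _
  have hind : ∀ k y : ℝ, ENNReal.ofReal (E.indicator (fun _ => k) y) =
      ENNReal.ofReal k * Measure.dirac y E := fun k y => by
    rw [Measure.dirac_apply' y hE.measurableSet]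
    by_cases hy : y ∈ E <;> simp [hy]
  calc ∫⁻ x in E ∩ Ioo (-R) R, ENNReal.ofReal (q x)
      ≤ ∫⁻ x in Ioo α β, ENNReal.ofReal (W' x + L) := by
        rw [hJeq]
        exact setLIntegral_mono' measurableSet_Ioo fun x hx =>
          ENNReal.ofReal_le_ofReal (hq x (hsubE hx))
    _ = ENNReal.ofReal (∫ x in Ioo α β, (W' x + L)) :=
        (ofReal_integral_eq_lintegral_ofReal (hint.mono_set Ioo_subset_Ioc_self)
          ((ae_restrict_iff' measurableSet_Ioo).2 (ae_of_all _ hpos))).symm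
    _ ≤ ENNReal.ofReal (L * (β - α) + E.indicator (fun _ => |W R|) R +
          E.indicator (fun _ => |W (-R)|) (-R)) := by
        rw [hFTC]
        exact ENNReal.ofReal_le_ofReal (by linarith)
    _ ≤ ENNReal.ofReal (L * (β - α)) + ENNReal.ofReal (E.indicator (fun _ => |W R|) R) +
          ENNReal.ofReal (E.indicator (fun _ => |W (-R)|) (-R)) :=
        ENNReal.ofReal_add_le.trans (add_le_add_left ENNReal.ofReal_add_le _)
    _ = _ := by
        rw [hind, hind, ENNReal.ofReal_mul' (sub_pos.2 hαβ).le, ← Real.volume_Ioo, ← hJeq]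
        simp [Measure.restrict_apply hE.measurableSet]

/-- Summing the bounds over all components. -/
lemma lintegral_iUnion_component_lt_top {E : ℕ → Set ℝ} (hE : ∀ i, IsOpen (E i))
    (hEc : ∀ i, (E i).OrdConnected) (hdisj : Pairwise fun i j => Disjoint (E i) (E j))
    {W W' q : ℝ → ℝ} {L : ℝ} (R : ℝ) (hd : ∀ x ∈ ⋃ i, E i, HasDerivAt W (W' x) x)
    (h0 : ∀ i, ∀ x ∈ frontier (E i), Tendsto W (𝓝[E i] x) (𝓝 0))
    (hq0 : ∀ x ∈ ⋃ i, E i, 0 ≤ q x) (hq : ∀ x ∈ ⋃ i, E i, q x ≤ W' x + L) :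
    ∫⁻ x in (⋃ i, E i) ∩ Ioo (-R) R, ENNReal.ofReal (q x) < ⊤ := by
  rw [iUnion_inter, lintegral_iUnion (fun i => ((hE i).inter isOpen_Ioo).measurableSet)
    (fun i j hij => (hdisj hij).mono inter_subset_left inter_subset_left)]
  refine (ENNReal.tsum_le_tsum fun i => lintegral_component_le (hE i) (hEc i) R
    (fun x hx => hd x (mem_iUnion_of_mem i hx)) (h0 i)
    (fun x hx => hq0 x (mem_iUnion_of_mem i hx))
    (fun x hx => hq x (mem_iUnion_of_mem i hx))).trans_lt ?_
  -- The bounds are values of one finite measure on disjoint sets, so they sum to its value on the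
  -- union; each atom ±R is counted at most once.
  rw [← measure_iUnion hdisj fun i => (hE i).measurableSet]
  refine (measure_mono (subset_univ _)).trans_lt ?_
  simpa using ENNReal.mul_lt_top ENNReal.ofReal_lt_top ENNReal.ofReal_lt_top

/-! ### Consequences of the first-order equation -/

/-- Differentiating the first-order equation; where `φ'` vanishes locally, so does `φ''`. -/
lemma abs_sq_deriv_add_le {U : Set ℝ} (hU : IsOpen U) {φ : ℝ → ℝ} {a c B : ℝ}
    (hφ : ContDiffOn ℝ ∞ φ U) (hB : ∀ x, |φ x| ≤ B) (hne : ∀ x ∈ U, φ x ≠ c)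
    (heq : ∀ x ∈ U, ∃ d, ∀ᶠ y in 𝓝 x, (deriv φ y) ^ 2 = waveF c a d (φ y)) :
    ∀ x ∈ U, |(deriv φ x) ^ 2 + 2 * (φ x - c) * deriv (deriv φ) x| ≤
      2 * |c| * B + 2 * B ^ 3 + |a| := by
  have hB0 : 0 ≤ B := (abs_nonneg _).trans (hB 0)
  have hφ1 : ContDiffOn ℝ ∞ (deriv φ) U := hφ.deriv_of_isOpen hU (by simp)
  have hφ2 : ContDiffOn ℝ ∞ (deriv (deriv φ)) U := hφ1.deriv_of_isOpen hU (by simp)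
  have hd : ∀ x ∈ U, HasDerivAt φ (deriv φ x) x := fun x hx =>
    ((hφ.differentiableOn (by simp)).differentiableAt (hU.mem_nhds hx)).hasDerivAt
  have hd1 : ∀ x ∈ U, HasDerivAt (deriv φ) (deriv (deriv φ) x) x := fun x hx =>
    ((hφ1.differentiableOn (by simp)).differentiableAt (hU.mem_nhds hx)).hasDerivAt
  have hne0 : ∀ x ∈ U, deriv φ x ≠ 0 →
      |(deriv φ x) ^ 2 + 2 * (φ x - c) * deriv (deriv φ) x| ≤
        2 * |c| * B + 2 * B ^ 3 + |a| := by
    intro x hx hx0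
    obtain ⟨d, hd'⟩ := heq x hx
    have hloc : (fun y => (deriv φ y) ^ 2 * (c - φ y)) =ᶠ[𝓝 x]
        fun y => φ y ^ 2 * (c - φ y ^ 2 / 2) + a * φ y + d := by
      filter_upwards [hd', hU.mem_nhds hx] with y hy hyU
      rw [hy, waveF, div_mul_cancel₀ _ (sub_ne_zero.2 (hne y hyU).symm)]
    have h1 := ((hd1 x hx).fun_pow 2).fun_mul ((hasDerivAt_const x c).fun_sub (hd x hx))
    have h2 := ((((hd x hx).fun_pow 2).fun_mul ((hasDerivAt_const x c).fun_sub
      (((hd x hx).fun_pow 2).div_const 2))).fun_add ((hd x hx).const_mul a)).add_const d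
    have h3 := h1.unique (h2.congr_of_eventuallyEq hloc)
    have h4 : deriv φ x * ((deriv φ x) ^ 2 + 2 * (φ x - c) * deriv (deriv φ) x) =
        deriv φ x * (-(2 * c * φ x - 2 * φ x ^ 3 + a)) := by
      norm_num at h3
      linear_combination -h3
    rw [mul_left_cancel₀ hx0 h4, abs_neg]
    calc |2 * c * φ x - 2 * φ x ^ 3 + a| ≤ |2 * c * φ x| + |2 * φ x ^ 3| + |a| :=
          (abs_add_le _ _).trans (add_le_add_left (abs_sub _ _) _)
      _ = 2 * |c| * |φ x| + 2 * |φ x| ^ 3 + |a| := by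
          rw [abs_mul, abs_mul, abs_mul, abs_pow, abs_two]
      _ ≤ _ := by
          have := hB x
          gcongr
  intro x hx
  -- Cancelling φ' needs φ' ≠ 0; the bound passes by continuity to limits of such points, and
  -- elsewhere φ' is locally zero.
  by_cases hfr : ∃ᶠ y in 𝓝 x, deriv φ y ≠ 0
  · have hc : ContinuousAt
        (fun y => |(deriv φ y) ^ 2 + 2 * (φ y - c) * deriv (deriv φ) y|) x := by
      have h0 := (hd x hx).continuousAt
      have h1 := (hd1 x hx).continuousAt
      have h2 := hφ2.continuousOn.continuousAt (hU.mem_nhds hx)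
      fun_prop
    by_contra! hlt
    obtain ⟨y, hy, hyU, hyl⟩ := (hfr.and_eventually
      ((eventually_mem_set.2 (hU.mem_nhds hx)).and (hc.eventually (lt_mem_nhds hlt)))).exists
    exact absurd (hne0 y hyU hy) hyl.not_ge
  · have h0 : deriv φ =ᶠ[𝓝 x] fun _ => 0 := by
      filter_upwards [not_frequently.1 hfr] with y hy using not_not.1 hy
    rw [h0.eq_of_nhds, h0.deriv_eq]
    simp only [deriv_const]
    norm_num
    positivity

/-- The flux `2 (φ - c) φ'` vanishes where `φ` tends to `c`. -/
lemma tendsto_flux_zero {E : Set ℝ} {φ : ℝ → ℝ} {a c d x : ℝ} (hne : ∀ y ∈ E, φ y ≠ c)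
    (heq : ∀ y ∈ E, (deriv φ y) ^ 2 = waveF c a d (φ y))
    (ht : Tendsto φ (𝓝[E] x) (𝓝 c)) :
    Tendsto (fun y => 2 * (φ y - c) * deriv φ y) (𝓝[E] x) (𝓝 0) := by
  -- The radicand at φ is the square of the flux: one factor c - φ survives the division.
  have hcont : Continuous fun y : ℝ =>
      √(4 * (c - y) * (y ^ 2 * (c - y ^ 2 / 2) + a * y + d)) := by fun_prop
  have h := (hcont.tendsto c).comp ht
  rw [sub_self, mul_zero, zero_mul, Real.sqrt_zero] at h
  rw [tendsto_zero_iff_abs_tendsto_zero]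
  refine h.congr' (eventually_of_mem self_mem_nhdsWithin fun y hy => ?_)
  have hyc : c - φ y ≠ 0 := sub_ne_zero.2 (hne y hy).symm
  simp only [Function.comp_apply]
  rw [← Real.sqrt_sq_eq_abs]
  congr 1
  rw [mul_pow, heq y hy, waveF]
  field_simp
  ring

/-! ### Measurability and local integrability -/

lemma measurable_indicator_of_continuousOn {U : Set ℝ} (hU : IsOpen U) {f : ℝ → ℝ}
    (hf : ContinuousOn f U) : Measurable (U.indicator f) := by
  classical
  rw [← piecewise_eq_indicator]
  exact hf.measurable_piecewise continuousOn_const hU.measurableSet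

lemma memLpLoc_one_iff {f : ℝ → ℝ} : MemLpLoc 1 f ↔ LocallyIntegrable f volume := by
  simp only [MemLpLoc, memLp_one_iff_integrable, locallyIntegrable_iff, IntegrableOn]

lemma memLpLoc_two_iff {f : ℝ → ℝ} (hf : Measurable f) :
    MemLpLoc 2 f ↔ LocallyIntegrable (fun x => f x ^ 2) volume := by
  simp only [MemLpLoc, memLp_two_iff_integrable_sq hf.aestronglyMeasurable,
    locallyIntegrable_iff, IntegrableOn]

end MCHWave

/-! ### Regularity of φ and of (φ - c)² -/

open MCHWave in
theorem mainTheorem8 (c : ℝ) (φ : ℝ → ℝ) (hbdd : ∃ B : ℝ, ∀ ξ, |φ ξ| ≤ B)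
    (hTW : ∃ (E : ℕ → Set ℝ) (C : Set ℝ), MCHWave.TW1 c φ E C ∧ MCHWave.TW2 c φ E C) :
    MCHWave.MemH1Loc φ ∧ MCHWave.TW3 c φ := by
  obtain ⟨B, hB⟩ := hbdd
  obtain ⟨E, C, hTW1, a, hTW2, -⟩ := hTW
  choose d heq hend using hTW2
  have hUo : IsOpen (⋃ i, E i) := isOpen_iUnion hTW1.isOpen
  set U := ⋃ i, E i with hU
  have hsub : ∀ i, E i ⊆ U := fun i => subset_iUnion E i
  have hoff : ∀ x ∉ U, φ x - c = 0 := fun x hx => by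
    rw [hU, ← hTW1.compl_eq, notMem_compl_iff] at hx
    rw [hTW1.eq_c x hx, sub_self]
  have hφ : ContDiffOn ℝ ∞ φ U := fun x hx => by
    obtain ⟨i, hi⟩ := mem_iUnion.1 hx
    exact ((hTW1.smooth i).contDiffAt ((hTW1.isOpen i).mem_nhds hi)).contDiffWithinAt
  have hφ1 : ContDiffOn ℝ ∞ (deriv φ) U := hφ.deriv_of_isOpen hUo (by simp)
  have hφ2 : ContDiffOn ℝ ∞ (deriv (deriv φ)) U := hφ1.deriv_of_isOpen hUo (by simp)
  have hc0 := hφ.continuousOn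
  have hc1 := hφ1.continuousOn
  have hc2 := hφ2.continuousOn
  have hd : ∀ x ∈ U, HasDerivAt φ (deriv φ x) x := fun x hx =>
    ((hφ.differentiableOn (by simp)).differentiableAt (hUo.mem_nhds hx)).hasDerivAt
  have hd1 : ∀ x ∈ U, HasDerivAt (deriv φ) (deriv (deriv φ) x) x := fun x hx =>
    ((hφ1.differentiableOn (by simp)).differentiableAt (hUo.mem_nhds hx)).hasDerivAt
  set L := 2 * |c| * B + 2 * B ^ 3 + |a| with hL
  have hr : ∀ x ∈ U, |(deriv φ x) ^ 2 + 2 * (φ x - c) * deriv (deriv φ) x| ≤ L :=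
    abs_sq_deriv_add_le hUo hφ hB hTW1.ne_c fun x hx => by
      obtain ⟨i, hi⟩ := mem_iUnion.1 hx
      exact ⟨d i, eventually_of_mem ((hTW1.isOpen i).mem_nhds hi) (heq i)⟩
  set w₁ : ℝ → ℝ := fun x => 2 * (φ x - c) * deriv φ x with hw₁
  set h : ℝ → ℝ := fun x => 2 * (deriv φ x) ^ 2 + 2 * (φ x - c) * deriv (deriv φ) x with hh
  have hw₁d : ∀ x ∈ U, HasDerivAt w₁ (h x) x := fun x hx => by
    refine ((((hd x hx).sub_const c).const_mul 2).fun_mul (hd1 x hx)).congr_deriv ?_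
    simp only [hh]
    ring
  have hw₁0 : ∀ i, ∀ x ∈ frontier (E i), Tendsto w₁ (𝓝[E i] x) (𝓝 0) := fun i x hx =>
    tendsto_flux_zero (fun y hy => hTW1.ne_c y (hsub i hy)) (heq i) (hend i x hx)
  have hp0 : ∀ i, ∀ x ∈ frontier (E i), Tendsto (fun y => φ y - c) (𝓝[E i] x) (𝓝 0) :=
    fun i x hx => by simpa using (hend i x hx).sub_const c
  have hw0 : ∀ i, ∀ x ∈ frontier (E i), Tendsto (fun y => (φ y - c) ^ 2) (𝓝[E i] x) (𝓝 0) :=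
    fun i x hx => by simpa using (hp0 i x hx).pow 2
  -- measurability
  have hpm : Measurable fun x => φ x - c := by
    have : U.indicator (fun x => φ x - c) = fun x => φ x - c :=
      indicator_eq_self.2 fun x hx => by_contra fun hxU => hx (hoff x hxU)
    rw [← this]
    exact measurable_indicator_of_continuousOn hUo (by fun_prop)
  have hφm : Measurable φ := by simpa using hpm.add_const c
  have hgm : Measurable (U.indicator (deriv φ)) := measurable_indicator_of_continuousOn hUo hc1
  have hhm : Measurable (U.indicator h) :=
    measurable_indicator_of_continuousOn hUo (by fun_prop)
  -- Off U the factor φ - c is zero, so the value of `deriv φ` there is irrelevant.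
  have hw₁eq : w₁ = fun x => 2 * (φ x - c) * U.indicator (deriv φ) x := by
    funext x
    by_cases hx : x ∈ U
    · simp [hw₁, hx]
    · simp [hw₁, hoff x hx]
  have hw₁m : Measurable w₁ := by
    rw [hw₁eq]
    fun_prop
  -- the energy is locally integrable
  have hQ : LocallyIntegrable (fun x => U.indicator (deriv φ) x ^ 2) volume := by
    refine locallyIntegrable_iff.2 fun K hK => ?_
    obtain ⟨R, hR⟩ := hK.isBounded.subset_ball 0
    rw [Real.ball_eq_Ioo, zero_sub, zero_add] at hR
    refine IntegrableOn.mono_set ⟨(hgm.pow_const 2).aestronglyMeasurable, ?_⟩ hR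
    rw [hasFiniteIntegral_iff_ofReal (ae_of_all _ fun x => sq_nonneg _)]
    have hind : (fun x => ENNReal.ofReal (U.indicator (deriv φ) x ^ 2)) =
        U.indicator fun x => ENNReal.ofReal ((deriv φ x) ^ 2) := by
      funext x
      by_cases hx : x ∈ U <;> simp [hx]
    rw [hind, lintegral_indicator hUo.measurableSet, Measure.restrict_restrict hUo.measurableSet]
    -- Applied with W = w₁ and q = φ'²: the lower bound -L in `hr` gives φ'² ≤ h + L.
    refine lintegral_iUnion_component_lt_top hTW1.isOpen hTW1.ordConnected hTW1.disjoint
      (L := L) R hw₁d hw₁0 (fun x _ => sq_nonneg _) fun x hx => ?_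
    have := (abs_le.1 (hr x hx)).1
    simp only [hh]
    linarith
  -- Every remaining function is dominated by a constant plus φ'²; products are handled by 2|uv| ≤
  -- u² + v².
  have hdom : ∀ {f : ℝ → ℝ} (A : ℝ), Measurable f →
      (∀ x, |f x| ≤ A + U.indicator (deriv φ) x ^ 2) → LocallyIntegrable f volume :=
    fun A hf hle => ((locallyIntegrable_const A).add hQ).mono hf.aestronglyMeasurable
      (ae_of_all _ fun x => (hle x).trans (le_abs_self _))
  have hpB : ∀ x, |φ x - c| ≤ B + |c| := fun x =>
    (abs_sub _ _).trans (add_le_add_left (hB x) _)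
  have hpB2 : ∀ x, (φ x - c) ^ 2 ≤ (B + |c|) ^ 2 := fun x =>
    sq_le_sq' (abs_le.1 (hpB x)).1 (abs_le.1 (hpB x)).2
  have hpi : LocallyIntegrable (fun x => φ x - c) volume :=
    hdom (B + |c|) hpm fun x => (hpB x).trans (le_add_of_nonneg_right (sq_nonneg _))
  have hφi : LocallyIntegrable (fun x => φ x ^ 2) volume :=
    hdom (B ^ 2) (hφm.pow_const 2) fun x => by
      rw [abs_pow]
      have := pow_le_pow_left₀ (abs_nonneg _) (hB x) 2
      nlinarith [sq_nonneg (U.indicator (deriv φ) x)]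
  have hgi : LocallyIntegrable (U.indicator (deriv φ)) volume :=
    hdom 1 hgm fun x => by
      rw [← sq_abs]
      nlinarith [sq_nonneg (|U.indicator (deriv φ) x| - 1), sq_abs (U.indicator (deriv φ) x)]
  have hwi : LocallyIntegrable (fun x => (φ x - c) ^ 2) volume :=
    hdom ((B + |c|) ^ 2) (hpm.pow_const 2) fun x => by
      rw [abs_of_nonneg (sq_nonneg _)]
      exact (hpB2 x).trans (le_add_of_nonneg_right (sq_nonneg _))
  have hw₁i : LocallyIntegrable w₁ volume :=
    hdom ((B + |c|) ^ 2) hw₁m fun x => by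
      rw [hw₁eq, abs_le]
      have := hpB2 x
      constructor
      · nlinarith [sq_nonneg (φ x - c + U.indicator (deriv φ) x)]
      · nlinarith [sq_nonneg (φ x - c - U.indicator (deriv φ) x)]
  have hhi : LocallyIntegrable (U.indicator h) volume :=
    hdom L hhm fun x => by
      by_cases hx : x ∈ U
      · have := abs_le.1 (hr x hx)
        simp only [indicator_of_mem hx, hh]
        rw [abs_le]
        constructor <;> nlinarith [sq_nonneg (deriv φ x)]
      · have hB0 : 0 ≤ B := (abs_nonneg _).trans (hB 0)
        simp only [indicator_of_notMem hx, hL]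
        norm_num
        positivity
  have hweak := @hasWeakDeriv_of_components E hTW1.isOpen hTW1.ordConnected hTW1.disjoint
  have hφw : HasWeakDeriv φ (U.indicator (deriv φ)) := by
    have := (hweak hpi hgi hoff (fun x hx => indicator_of_notMem hx _)
      (fun x hx => by rw [indicator_of_mem hx]; exact (hd x hx).sub_const c) hp0).add_const c
    simpa using this
  have hww : HasWeakDeriv (fun x => (φ x - c) ^ 2) w₁ :=
    hweak hwi hw₁i (fun x hx => by simp [hoff x hx]) (fun x hx => by simp [hw₁, hoff x hx])
      (fun x hx => by simpa using ((hd x hx).sub_const c).fun_pow 2) hw0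
  have hw₁w : HasWeakDeriv w₁ (U.indicator h) :=
    hweak hw₁i hhi (fun x hx => by simp [hw₁, hoff x hx]) (fun x hx => indicator_of_notMem hx _)
      (fun x hx => by rw [indicator_of_mem hx]; exact hw₁d x hx) hw₁0
  exact ⟨⟨(memLpLoc_two_iff hφm).2 hφi, _, hφw, (memLpLoc_two_iff hgm).2 hQ⟩,
    memLpLoc_one_iff.2 hwi, w₁, hww, memLpLoc_one_iff.2 hw₁i, _, hw₁w, memLpLoc_one_iff.2 hhi⟩
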